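/- Let $d\ge 1$, let $\Omega\subset\mathbb R^d$ be a bounded open set, and let $M_1,\dots,M_N$ be symmetric positive definite $d\times d$ real matrices with smallest eigenvalues $\lambda_1(M_j)$. Let $q_1,\dots,q_N\ge 0$ satisfy $\sum_{j=1}^N q_j=|\Omega|$ (Lebesgue measure), let $\mu_1,\dots,\mu_m>0$ and let $f_1,\dots,f_m\in H^{-1}(\Omega)$, the dual of $H^1_0(\Omega)$. Put $K=\{t\in[0,1]^N:\sum_j t_j=1\}$ and define $\lambda_-$ on $K$ by $\frac1{\lambda_-(t)}=\sum_{j=1}^N\frac{t_j}{\lambda_1(M_j)}$. Let $$\mathcal T=\Bigl\{\theta\in L^\infty(\Omega;K):\int_\Omega\theta_j\,dx=q_j,\ j=1,\dots,N\Bigr\},$$ $$\mathcal S=\bigl\{\sigma\in L^2(\Omega;\mathbb R^d)^m:-\operatorname{div}\sigma_i=f_i\text{ in }H^{-1}(\Omega),\ i=1,\dots,m\bigr\},$$ $$H(\theta,\sigma)=\sum_{i=1}^m\mu_i\int_\Omega\frac{|\sigma_i|^2}{\lambda_-(\theta)}\,dx\qquad(\theta\in\mathcal T,\ \sigma\in\mathcal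 S).$$ Then: 1. For every $\theta\in\mathcal T$ and every $i$ the problem $-\operatorname{div}(\lambda_-(\theta)\nabla u_i)=f_i$ has a unique weak solution $u_i\in H^1_0(\Omega)$. Put $I(\theta)=\sum_{i=1}^m\mu_i\langle f_i,u_i\rangle$. 2. $H$ has a saddle point on $\mathcal T\times\mathcal S$, that is, a pair $(\theta^*,\sigma^*)\in\mathcal T\times\mathcal S$ with $$H(\theta,\sigma^*)\le H(\theta^*,\sigma^*)\le H(\theta^*,\sigma)\qquad\text{for all }\theta\in\mathcal T,\ \sigma\in\mathcal S,$$ and all saddle points have the same second component $\sigma^*$. Thus, with $\mathcal T^*$ the (nonempty) set of first components of saddle points, the set of all saddle points is $\mathcal T^*\times\{\sigma^*\}$. 3. The set of maximizers of $I$ over $\mathcal T$ is equal to $\mathcal T^*$. -/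

import Mathlib

open MeasureTheory
open scoped ENNReal ContDiff

/-- The space `ℝ^d` with the Euclidean norm. -/
abbrev Euc (d : ℕ) : Type := EuclideanSpace ℝ (Fin d)

/-- Lebesgue measure on `Ω`. -/
noncomputable abbrev lebOn {d : ℕ} (Ω : Set (Euc d)) : Measure (Euc d) := volume.restrict Ω

/-- `L²(Ω; ℝ^d)`. -/
abbrev L2Vec {d : ℕ} (Ω : Set (Euc d)) : Type := Lp (Euc d) 2 (lebOn Ω)

/-- The Hilbert space `L²(Ω) × L²(Ω; ℝ^d)` with the norm `(‖v‖² + ‖g‖²)^(1/2)`. The space `H¹(Ω)`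
is (isometrically) its closed subspace of all pairs `(v, ∇v)`. -/
abbrev L2Pair {d : ℕ} (Ω : Set (Euc d)) : Type := WithLp 2 (Lp ℝ 2 (lebOn Ω) × L2Vec Ω)

/-- The image of `C_c^∞(Ω)` in `H¹(Ω)`: all pairs `(φ, ∇φ)` with `φ` smooth and compactly supported
in `Ω`. -/
noncomputable def testPairs {d : ℕ} (Ω : Set (Euc d)) : Submodule ℝ (L2Pair Ω) where
  carrier := {p | ∃ φ : Euc d → ℝ, ContDiff ℝ ∞ φ ∧ HasCompactSupport φ ∧ tsupport φ ⊆ Ω ∧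
    (p.fst : Euc d → ℝ) =ᵐ[lebOn Ω] φ ∧ (p.snd : Euc d → Euc d) =ᵐ[lebOn Ω] gradient φ}
  zero_mem' := by
    refine ⟨0, contDiff_const, HasCompactSupport.zero, by simp [tsupport], ?_, ?_⟩
    · exact Lp.coeFn_zero _ _ _
    · refine (Lp.coeFn_zero _ _ _).trans (Filter.Eventually.of_forall fun x => ?_)
      simp [gradient]
  add_mem' := by
    rintro p p' ⟨φ, h1, h2, h3, h4, h5⟩ ⟨ψ, k1, k2, k3, k4, k5⟩
    refine ⟨φ + ψ, h1.add k1, h2.add k2,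
      (tsupport_add φ ψ).trans (Set.union_subset h3 k3), ?_, ?_⟩
    · exact (Lp.coeFn_add _ _).trans (h4.add k4)
    · refine ((Lp.coeFn_add _ _).trans (h5.add k5)).trans (Filter.Eventually.of_forall fun x => ?_)
      have a := (h1.differentiable (by simp)) x
      have b := (k1.differentiable (by simp)) x
      simp [gradient, fderiv_add a b]
  smul_mem' := by
    rintro c p ⟨φ, h1, h2, h3, h4, h5⟩
    refine ⟨c • φ, h1.const_smul c, h2.smul_left (f := fun _ => c),
      (tsupport_smul_subset_right (fun _ => c) φ).trans h3, ?_, ?_⟩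
    · exact (Lp.coeFn_smul _ _).trans (h4.const_smul c)
    · refine ((Lp.coeFn_smul _ _).trans (h5.const_smul c)).trans
        (Filter.Eventually.of_forall fun x => ?_)
      have a := (h1.differentiable (by simp)) x
      simp [gradient, fderiv_const_smul a c]

/-- The Sobolev space `H¹₀(Ω)`: the closure of `C_c^∞(Ω)` in the `H¹` norm, an element `v` being
represented by the pair `(v, ∇v)`. -/
noncomputable def H10 {d : ℕ} (Ω : Set (Euc d)) : Submodule ℝ (L2Pair Ω) :=
  (testPairs Ω).topologicalClosure

/-- The weak gradient `∇v ∈ L²(Ω; ℝ^d)` of `v ∈ H¹₀(Ω)`. -/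
noncomputable def H10.grad {d : ℕ} {Ω : Set (Euc d)} (v : H10 Ω) : L2Vec Ω :=
  (v : L2Pair Ω).snd

/-- `H⁻¹(Ω)`, the dual of `H¹₀(Ω)`. -/
abbrev HNeg1 {d : ℕ} (Ω : Set (Euc d)) : Type := StrongDual ℝ (H10 Ω)

/-- The smallest eigenvalue `λ₁(A)` of a symmetric matrix `A`. -/
noncomputable def minEig {d : ℕ} (A : Matrix (Fin d) (Fin d) ℝ) : ℝ := sInf (spectrum ℝ A)

/-- `λ₋(t)`, where `1 / λ₋(t) = ∑ j, t j / λ₁(M j)`. -/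
noncomputable def lamMinus {d N : ℕ} (M : Fin N → Matrix (Fin d) (Fin d) ℝ) (t : Fin N → ℝ) : ℝ :=
  (∑ j, t j / minEig (M j))⁻¹

/-- The set `𝒯` of all `θ ∈ L^∞(Ω; K)`, `K = {t ∈ [0,1]^N : ∑ t j = 1}`, with `∫_Ω θ j = q j` for
all `j`. -/
def designs {d N : ℕ} (Ω : Set (Euc d)) (q : Fin N → ℝ) : Set (Lp (Fin N → ℝ) ∞ (lebOn Ω)) :=
  {θ | (∀ᵐ x ∂(lebOn Ω), (∀ j, θ x j ∈ Set.Icc (0 : ℝ) 1) ∧ ∑ j, θ x j = 1) ∧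
    ∀ j, ∫ x in Ω, θ x j = q j}

/-- The set `𝒮` of all `σ ∈ L²(Ω; ℝ^d)^m` with `-div (σ i) = f i` in `H⁻¹(Ω)` for all `i`. -/
def fluxes {d m : ℕ} {Ω : Set (Euc d)} (f : Fin m → HNeg1 Ω) : Set (Fin m → L2Vec Ω) :=
  {σ | ∀ i, ∀ v : H10 Ω, ∫ x in Ω, inner ℝ (σ i x) (H10.grad v x) = f i v}

/-- `u ∈ H¹₀(Ω)` is a weak solution of `-div (λ₋(θ) ∇u) = g`. -/
def IsState {d N : ℕ} {Ω : Set (Euc d)} (M : Fin N → Matrix (Fin d) (Fin d) ℝ)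
    (θ : Lp (Fin N → ℝ) ∞ (lebOn Ω)) (g : HNeg1 Ω) (u : H10 Ω) : Prop :=
  ∀ v : H10 Ω, ∫ x in Ω, lamMinus M (θ x) * inner ℝ (H10.grad u x) (H10.grad v x) = g v

/-- The weak solution `u ∈ H¹₀(Ω)` of `-div (λ₋(θ) ∇u) = g` (an arbitrary element of `H¹₀(Ω)` if
there is none). -/
noncomputable def state {d N : ℕ} {Ω : Set (Euc d)} (M : Fin N → Matrix (Fin d) (Fin d) ℝ)
    (θ : Lp (Fin N → ℝ) ∞ (lebOn Ω)) (g : HNeg1 Ω) : H10 Ω :=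
  Classical.epsilon (IsState M θ g)

/-- The energy `I(θ) = ∑ i, w i ⟨f i, u i⟩`, where `u i` solves `-div (λ₋(θ) ∇(u i)) = f i`. -/
noncomputable def energyI {d N m : ℕ} {Ω : Set (Euc d)} (M : Fin N → Matrix (Fin d) (Fin d) ℝ)
    (w : Fin m → ℝ) (f : Fin m → HNeg1 Ω) (θ : Lp (Fin N → ℝ) ∞ (lebOn Ω)) : ℝ :=
  ∑ i, w i * f i (state M θ (f i))

/-- The functional `H(θ, σ) = ∑ i, w i ∫_Ω |σ i|² / λ₋(θ)`. -/
noncomputable def funH {d N m : ℕ} {Ω : Set (Euc d)} (M : Fin N → Matrix (Fin d) (Fin d) ℝ)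
    (w : Fin m → ℝ) (θ : Lp (Fin N → ℝ) ∞ (lebOn Ω)) (σ : Fin m → L2Vec Ω) : ℝ :=
  ∑ i, w i * ∫ x in Ω, ‖σ i x‖ ^ 2 / lamMinus M (θ x)

/-- The set of saddle points `(θ, σ)` of `H` on `𝒯 × 𝒮` (maximum in `θ`, minimum in `σ`). -/
def saddlePoints {d N m : ℕ} {Ω : Set (Euc d)} (M : Fin N → Matrix (Fin d) (Fin d) ℝ)
    (q : Fin N → ℝ) (w : Fin m → ℝ) (f : Fin m → HNeg1 Ω) :
    Set (Lp (Fin N → ℝ) ∞ (lebOn Ω) × (Fin m → L2Vec Ω)) :=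
  {p | p.1 ∈ designs Ω q ∧ p.2 ∈ fluxes f ∧
    (∀ θ ∈ designs Ω q, funH M w θ p.2 ≤ funH M w p.1 p.2) ∧
    ∀ σ ∈ fluxes f, funH M w p.1 p.2 ≤ funH M w p.1 σ}

/-- The set `𝒯*` of first components of saddle points. -/
def optDesigns {d N m : ℕ} {Ω : Set (Euc d)} (M : Fin N → Matrix (Fin d) (Fin d) ℝ)
    (q : Fin N → ℝ) (w : Fin m → ℝ) (f : Fin m → HNeg1 Ω) : Set (Lp (Fin N → ℝ) ∞ (lebOn Ω)) :=
  Prod.fst '' saddlePoints M q w f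

/-! Since `1 / λ₋` is linear, `H` is affine in `θ` and a coercive quadratic form in `σ`. For fixed
`θ` the flux `τ = λ₋(θ)∇u` minimizes `H(θ, ·)` over `𝒮` with value `I(θ)`. Indeed `τ / λ₋(θ)` is a
gradient, hence orthogonal to differences of fluxes, so that `H(θ, σ) ≥ I(θ) + κ‖σ - τ‖²` with `κ`
independent of `θ` (`funH_eq_energyI_add`, `energyI_add_le_funH`).

So `I` is an infimum of weak-* continuous affine functionals on the weak-* compact convex set `𝒯`,
and it attains its maximum (`exists_design_cluster`, `exists_isMax_energyI`). A maximizer `θ`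
together with its flux is a saddle point: along the segment from `θ` to `θ'` the fluxes converge to
that of `θ`, and the first-order optimality condition becomes `H(θ', τ) ≤ H(θ, τ)`
(`isSaddle_of_isMax`). Conversely, for a saddle point `(θ*, σ*)` the component `σ*` is the flux of
`θ*`, and `I(θ') ≤ H(θ', σ*) ≤ I(θ*)`. If `θ'` is also a maximizer, equality holds throughout, so
`σ*` is the flux of `θ'` too; this makes `σ*` unique. -/

/-! ### Weak compactness from closed convex hulls of tails. -/

/-- A decreasing sequence of nonempty closed convex subsets of a bounded subset of a Hilbert space
has a common point. -/
theorem exists_mem_of_antitone_closed_convex {X : Type*} [NormedAddCommGroup X]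
    [InnerProductSpace ℝ X] [CompleteSpace X] {C : ℕ → Set X} (hne : ∀ n, (C n).Nonempty)
    (hcl : ∀ n, IsClosed (C n)) (hcv : ∀ n, Convex ℝ (C n)) (hanti : Antitone C) {R : ℝ}
    (hR : ∀ x ∈ C 0, ‖x‖ ≤ R) : ∃ x, ∀ n, x ∈ C n := by
  have hmin : ∀ n, ∃ x ∈ C n, ∀ y ∈ C n, ‖x‖ ≤ ‖y‖ := by
    intro n
    obtain ⟨x, hx, hxe⟩ :=
      exists_norm_eq_iInf_of_complete_convex (hne n) (hcl n).isComplete (hcv n) 0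
    refine ⟨x, hx, fun y hy => ?_⟩
    have h1 : (⨅ w : C n, ‖(0 : X) - w‖) ≤ ‖(0 : X) - y‖ :=
      ciInf_le ⟨0, Set.forall_mem_range.2 fun _ => norm_nonneg _⟩ (⟨y, hy⟩ : C n)
    simpa [zero_sub, norm_neg] using hxe.le.trans h1
  choose x hx hxm using hmin
  have hmono : Monotone fun n => ‖x n‖ ^ 2 := fun n k hnk => by
    have := hxm n _ (hanti hnk (hx k))
    dsimp only
    gcongr
  have hbdd : BddAbove (Set.range fun n => ‖x n‖ ^ 2) := by
    refine ⟨R ^ 2, ?_⟩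
    rintro _ ⟨n, rfl⟩
    have := hR _ (hanti (Nat.zero_le n) (hx n))
    dsimp only
    gcongr
  have hlim := tendsto_atTop_ciSup hmono hbdd
  have hcau : CauchySeq x := by
    rw [Metric.cauchySeq_iff']
    intro ε hε
    -- The midpoint of `x k` and `x n` lies in `C n`, so its norm is at least `‖x n‖`, and the
    -- parallelogram law gives `‖x k - x n‖² ≤ 2 (‖x k‖² - ‖x n‖²)`.
    obtain ⟨n, hn⟩ := (Metric.cauchySeq_iff'.1 hlim.cauchySeq) (ε ^ 2 / 2) (by positivity)
    refine ⟨n, fun k hk => ?_⟩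
    have h1 := hn k hk
    rw [Real.dist_eq, abs_of_nonneg (sub_nonneg.2 (hmono hk))] at h1
    have hmid : (1 / 2 : ℝ) • x k + (1 / 2 : ℝ) • x n ∈ C n :=
      hcv n (hanti hk (hx k)) (hx n) (by norm_num) (by norm_num) (by norm_num)
    have h2 := hxm n _ hmid
    rw [← smul_add, norm_smul] at h2
    norm_num at h2
    have h3 := parallelogram_law_with_norm ℝ (x k) (x n)
    have h4 : 0 ≤ ‖x n‖ := norm_nonneg _
    rw [dist_eq_norm]
    have h5 : ‖x k - x n‖ ^ 2 < ε ^ 2 := by nlinarith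
    exact lt_of_pow_lt_pow_left₀ 2 hε.le h5
  obtain ⟨y, hy⟩ := cauchySeq_tendsto_of_complete hcau
  refine ⟨y, fun n => (hcl n).mem_of_tendsto hy ?_⟩
  filter_upwards [Filter.eventually_ge_atTop n] with k hk using hanti hk (hx k)

theorem integrable_inner_of_mem_bounded {α V : Type*} [MeasurableSpace α] {μ : Measure α}
    [NormedAddCommGroup V] [InnerProductSpace ℝ V] {K : Set V} {R : ℝ} (hKb : ∀ t ∈ K, ‖t‖ ≤ R)
    {g h : α → V} (hg : AEStronglyMeasurable g μ) (hgK : ∀ᵐ x ∂μ, g x ∈ K) (hh : Integrable h μ) :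
    Integrable (fun x => inner ℝ (g x) (h x)) μ := by
  refine Integrable.mono' (hh.norm.const_mul R) (hg.inner hh.1) ?_
  filter_upwards [hgK] with x hx
  exact (norm_inner_le_norm _ _).trans (by gcongr; exact hKb _ hx)

/-- Sequential weak compactness, in the form of one-sided estimates, of the measurable functions
with values in a bounded closed convex set. -/
theorem exists_weak_cluster {α V : Type*} [MeasurableSpace α] {μ : Measure α} [IsFiniteMeasure μ]
    [NormedAddCommGroup V] [InnerProductSpace ℝ V] [CompleteSpace V] {K : Set V}
    (hKc : IsClosed K) (hKv : Convex ℝ K) {R : ℝ} (hKb : ∀ t ∈ K, ‖t‖ ≤ R) {g : ℕ → α → V}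
    (hg : ∀ n, AEStronglyMeasurable (g n) μ) (hgK : ∀ n, ∀ᵐ x ∂μ, g n x ∈ K) :
    ∃ ψ : α → V, AEStronglyMeasurable ψ μ ∧ (∀ᵐ x ∂μ, ψ x ∈ K) ∧
      ∀ h : α → V, Integrable h μ → ∀ c : ℝ,
        (∀ᶠ n in Filter.atTop, c ≤ ∫ x, inner ℝ (g n x) (h x) ∂μ) →
          c ≤ ∫ x, inner ℝ (ψ x) (h x) ∂μ := by
  have hmem : ∀ n, MemLp (g n) 2 μ := fun n =>
    MemLp.of_bound (hg n) R (by filter_upwards [hgK n] with x hx using hKb _ hx)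
  let G : ℕ → Lp V 2 μ := fun n => (hmem n).toLp
  let A : (α → V) → ℝ → Set (Lp V 2 μ) := fun h c =>
    {ψ | (∀ᵐ x ∂μ, ψ x ∈ K) ∧ c ≤ ∫ x, inner ℝ (ψ x) (h x) ∂μ}
  have hAconv : ∀ h c, Integrable h μ → Convex ℝ (A h c) := by
    rintro h c hh φ ⟨hφ, hφc⟩ ψ ⟨hψ, hψc⟩ a b ha hb hab
    have hco : (a • φ + b • ψ : Lp V 2 μ) =ᵐ[μ] fun x => a • φ x + b • ψ x := by
      filter_upwards [Lp.coeFn_add (a • φ) (b • ψ), Lp.coeFn_smul a φ, Lp.coeFn_smul b ψ]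
        with x h1 h2 h3
      rw [h1, Pi.add_apply, h2, h3]
      rfl
    refine ⟨?_, ?_⟩
    · filter_upwards [hco, hφ, hψ] with x h1 h2 h3
      rw [h1]
      exact hKv h2 h3 ha hb hab
    · have h1 := integrable_inner_of_mem_bounded hKb (Lp.aestronglyMeasurable φ) hφ hh
      have h2 := integrable_inner_of_mem_bounded hKb (Lp.aestronglyMeasurable ψ) hψ hh
      have h3 : ∫ x, inner ℝ ((a • φ + b • ψ : Lp V 2 μ) x) (h x) ∂μ
          = a * ∫ x, inner ℝ (φ x) (h x) ∂μ + b * ∫ x, inner ℝ (ψ x) (h x) ∂μ := by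
        rw [← integral_const_mul, ← integral_const_mul,
          ← integral_add (h1.const_mul a) (h2.const_mul b)]
        refine integral_congr_ae ?_
        filter_upwards [hco] with x hx
        rw [hx, inner_add_left, real_inner_smul_left, real_inner_smul_left]
      rw [h3]
      calc c = a * c + b * c := by rw [← add_mul, hab, one_mul]
        _ ≤ _ := by gcongr
  have hAcl : ∀ h c, Integrable h μ → IsClosed (A h c) := by
    intro h c hh
    refine IsSeqClosed.isClosed fun u ψ hu hlim => ?_
    -- Since `h` is merely integrable, continuity of the `L²` inner product is not available;
    -- dominated convergence along an a.e. convergent subsequence, with bound `R * ‖h x‖`, replaces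
    -- it.
    obtain ⟨ns, hns, hae⟩ := (tendstoInMeasure_of_tendsto_Lp hlim).exists_seq_tendsto_ae
    have huK : ∀ᵐ x ∂μ, ∀ n, u n x ∈ K := ae_all_iff.2 fun n => (hu n).1
    refine ⟨?_, ?_⟩
    · filter_upwards [hae, huK] with x h1 h2
      exact hKc.mem_of_tendsto h1 (Filter.Eventually.of_forall fun n => h2 _)
    · refine ge_of_tendsto' (tendsto_integral_of_dominated_convergence (fun x => R * ‖h x‖)
        (fun n => (Lp.aestronglyMeasurable (u (ns n))).inner hh.1) (hh.norm.const_mul R)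
        (fun n => ?_) ?_) fun n => (hu (ns n)).2
      · filter_upwards [huK] with x hx
        exact (norm_inner_le_norm _ _).trans (by gcongr; exact hKb _ (hx _))
      · filter_upwards [hae] with x hx using hx.inner tendsto_const_nhds
  -- A point common to all these sets satisfies every closed convex constraint that holds eventually
  -- along the sequence, so it serves as a weak cluster point.
  let C : ℕ → Set (Lp V 2 μ) := fun n => closure (convexHull ℝ (G '' Set.Ici n))
  have hsub : ∀ n h c, Integrable h μ → (∀ k, n ≤ k → c ≤ ∫ x, inner ℝ (g k x) (h x) ∂μ) →
      C n ⊆ A h c := by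
    intro n h c hh hc
    refine closure_minimal (convexHull_min ?_ (hAconv h c hh)) (hAcl h c hh)
    rintro _ ⟨k, hk, rfl⟩
    have hk' := (hmem k).coeFn_toLp
    refine ⟨?_, (hc k hk).trans_eq (integral_congr_ae ?_)⟩
    · filter_upwards [hk', hgK k] with x h1 h2
      exact (congrArg (· ∈ K) h1).mpr h2
    · filter_upwards [hk'] with x h1
      exact congrArg (fun y => inner ℝ y (h x)) h1.symm
  have hC0 : C 0 ⊆ A 0 0 := hsub 0 0 0 (integrable_zero _ _ _) (by simp)
  obtain ⟨ψ, hψ⟩ := exists_mem_of_antitone_closed_convex (C := C)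
    (R := (measureUnivNNReal μ : ℝ) ^ (2⁻¹ : ℝ) * R)
    (fun n => ((Set.nonempty_Ici.image G).convexHull (𝕜 := ℝ)).closure) (fun n => isClosed_closure)
    (fun n => (convex_convexHull ℝ _).closure)
    (fun n k hnk => closure_mono (convexHull_mono (Set.image_mono (Set.Ici_subset_Ici.2 hnk))))
    (fun φ hφ => by
      have hφK := (hC0 hφ).1
      -- For `μ = 0` the set `K` may be empty and `R` negative.
      rcases eq_or_ne μ 0 with rfl | hμ
      · have : φ = 0 := by
          apply Lp.ext
          simp [Filter.EventuallyEq]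
        simp [this]
      · have : (ae μ).NeBot := ae_neBot.2 hμ
        obtain ⟨x, hx⟩ := hφK.exists
        have hR : 0 ≤ R := (norm_nonneg _).trans (hKb _ hx)
        have := Lp.norm_le_of_ae_bound (p := 2) hR
          (by filter_upwards [hφK] with x hx using hKb _ hx)
        simpa using this)
  refine ⟨ψ, Lp.aestronglyMeasurable ψ, (hC0 (hψ 0)).1, fun h hh c hc => ?_⟩
  obtain ⟨n, hn⟩ := Filter.eventually_atTop.1 hc
  exact (hsub n h c hh hn (hψ n)).2

/-! ### From maximizers to saddle points. -/

/-- Saddle points of a function that is affine in the first variable and whose value is bounded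
below by its minimum plus a multiple of the square of the distance to the minimizer, in the second
variable. -/
theorem isSaddle_of_isMax {V E : Type*} [AddCommGroup V] [Module ℝ V] [NormedAddCommGroup E]
    {T : Set V} (hT : Convex ℝ T) {S : Set E} {H : V → E → ℝ} {J : V → ℝ} {s : V → E} {κ : ℝ}
    (hκ : 0 < κ)
    (haff : ∀ θ θ' σ, ∀ r : ℝ, H ((1 - r) • θ + r • θ') σ = (1 - r) * H θ σ + r * H θ' σ)
    (hcont : ∀ θ ∈ T, Continuous (H θ)) (hs : ∀ θ ∈ T, s θ ∈ S)
    (hJ : ∀ θ ∈ T, H θ (s θ) = J θ)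
    (hmin : ∀ θ ∈ T, ∀ σ ∈ S, J θ + κ * ‖σ - s θ‖ ^ 2 ≤ H θ σ)
    {θ : V} (hθ : θ ∈ T) (hmax : ∀ θ' ∈ T, J θ' ≤ J θ) {θ' : V} (hθ' : θ' ∈ T) :
    H θ' (s θ) ≤ H θ (s θ) := by
  have hmin' : ∀ η ∈ T, ∀ σ ∈ S, J η ≤ H η σ := fun η hη σ hσ =>
    (le_add_of_nonneg_right (by positivity)).trans (hmin η hη σ hσ)
  let r : ℕ → ℝ := fun n => 1 / ((n : ℝ) + 1)
  have hr0 : ∀ n, 0 < r n := fun n => by positivity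
  have hr1 : ∀ n, r n ≤ 1 := fun n => by
    rw [div_le_one (by positivity)]
    linarith [(Nat.cast_nonneg n : (0 : ℝ) ≤ n)]
  let η : ℕ → V := fun n => (1 - r n) • θ + r n • θ'
  have hη : ∀ n, η n ∈ T := fun n =>
    hT hθ hθ' (sub_nonneg.2 (hr1 n)) (hr0 n).le (by ring)
  have hle : ∀ n, H θ' (s (η n)) ≤ H θ (s θ) := by
    intro n
    have h1 : J (η n) = (1 - r n) * H θ (s (η n)) + r n * H θ' (s (η n)) := by
      rw [← hJ _ (hη n), haff]
    have h2 := hmax _ (hη n)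
    have h3 := hmin' θ hθ _ (hs _ (hη n))
    have h4 := mul_le_mul_of_nonneg_left h3 (sub_nonneg.2 (hr1 n))
    -- Maximality bounds `J (η n)` above by `J θ`, while its part at `θ` is at least `(1 - r n) * J
    -- θ`; only `r n * J θ` remains for the part at `θ'`.
    have h5 : r n * H θ' (s (η n)) ≤ r n * J θ := by nlinarith
    rw [hJ θ hθ]
    exact le_of_mul_le_mul_left h5 (hr0 n)
  -- `J` is concave on the segment, so the gap `H (η n) (s θ) - J (η n)`, which controls the squared
  -- distance, is at most `r n * (H θ' (s θ) - J θ')`.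
  have hdist : ∀ n, ‖s θ - s (η n)‖ ^ 2 ≤ r n * ((H θ' (s θ) - J θ') / κ) := by
    intro n
    have h1 := hmin _ (hη n) _ (hs θ hθ)
    have h2 : H (η n) (s θ) = (1 - r n) * J θ + r n * H θ' (s θ) := by rw [haff, hJ θ hθ]
    have h3 : J (η n) = (1 - r n) * H θ (s (η n)) + r n * H θ' (s (η n)) := by
      rw [← hJ _ (hη n), haff]
    have h4 := mul_le_mul_of_nonneg_left (hmin' θ hθ _ (hs _ (hη n))) (sub_nonneg.2 (hr1 n))
    have h5 := mul_le_mul_of_nonneg_left (hmin' θ' hθ' _ (hs _ (hη n))) (hr0 n).le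
    rw [mul_div_assoc', le_div_iff₀ hκ]
    linarith
  have hlim : Filter.Tendsto (fun n => s (η n)) Filter.atTop (nhds (s θ)) := by
    rw [tendsto_iff_norm_sub_tendsto_zero]
    have h1 : Filter.Tendsto (fun n => r n * ((H θ' (s θ) - J θ') / κ)) Filter.atTop (nhds 0) := by
      simpa [r] using
        (tendsto_one_div_add_atTop_nhds_zero_nat (𝕜 := ℝ)).mul_const ((H θ' (s θ) - J θ') / κ)
    have h2 : Filter.Tendsto (fun n => ‖s (η n) - s θ‖ ^ 2) Filter.atTop (nhds 0) := by
      refine squeeze_zero (fun n => by positivity) (fun n => ?_) h1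
      rw [norm_sub_rev]
      exact hdist n
    simpa using h2.sqrt
  exact le_of_tendsto' (((hcont θ' hθ').tendsto _).comp hlim) hle

/-! ### Positivity of the smallest eigenvalue, and the Poincaré inequality. -/

theorem minEig_pos {d : ℕ} (hd : 0 < d) {A : Matrix (Fin d) (Fin d) ℝ} (hA : A.PosDef) :
    0 < minEig A := by
  have : Nonempty (Fin d) := ⟨⟨0, hd⟩⟩
  rw [minEig, hA.isHermitian.spectrum_real_eq_range_eigenvalues]
  obtain ⟨i, hi⟩ := (Set.range_nonempty hA.isHermitian.eigenvalues).csInf_mem (Set.finite_range _)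
  rw [← hi]
  exact hA.eigenvalues_pos i

theorem norm_sq_eq_integral {α E : Type*} [MeasurableSpace α] {μ : Measure α}
    [NormedAddCommGroup E] [InnerProductSpace ℝ E] (g : Lp E 2 μ) :
    ‖g‖ ^ 2 = ∫ x, ‖g x‖ ^ 2 ∂μ := by
  rw [← real_inner_self_eq_norm_sq, L2.inner_def]
  simp

/-- The Poincaré inequality for test functions. -/
theorem integral_sq_le_of_tsupport_subset_ball {E : Type*} [NormedAddCommGroup E]
    [InnerProductSpace ℝ E] [FiniteDimensional ℝ E] [MeasurableSpace E] [BorelSpace E] {e : E}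
    (he : ‖e‖ = 1) {R : ℝ} {φ : E → ℝ} (hφ : ContDiff ℝ ∞ φ) (hc : HasCompactSupport φ)
    (hs : tsupport φ ⊆ Metric.closedBall 0 R) :
    ∫ x, φ x ^ 2 ≤ 4 * R ^ 2 * ∫ x, ‖gradient φ x‖ ^ 2 := by
  obtain ⟨X, hXe, hX⟩ : ∃ X : E →L[ℝ] ℝ, X e = 1 ∧ ∀ x, |X x| ≤ ‖x‖ :=
    ⟨innerSL ℝ e, by simp [he], fun x => by simpa [he] using abs_real_inner_le_norm e x⟩
  have hφd : Differentiable ℝ φ := hφ.differentiable (by simp)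
  have hφ' : Continuous fun x => fderiv ℝ φ x := hφ.continuous_fderiv (by simp)
  have hgc : Continuous (gradient φ) :=
    (InnerProductSpace.toDual ℝ E).symm.continuous.comp hφ'
  have hgs : HasCompactSupport (gradient φ) :=
    (hc.fderiv (𝕜 := ℝ)).comp_left (g := (InnerProductSpace.toDual ℝ E).symm) (map_zero _)
  have hder : ∀ x, fderiv ℝ (fun y => X y * φ y) x e = X x * fderiv ℝ φ x e + φ x := by
    intro x
    rw [fderiv_fun_mul X.differentiableAt (hφd x)]
    simp [hXe]
  have hφc := hφ.continuous
  have hfe : Continuous fun x => fderiv ℝ φ x e := hφ'.clm_apply continuous_const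
  have i1 : Integrable (fun x => φ x ^ 2) := by
    simp_rw [sq]
    exact (hφc.mul hφc).integrable_of_hasCompactSupport hc.mul_right
  have i2 : Integrable (fun x => ‖gradient φ x‖ ^ 2) := by
    simp_rw [sq]
    exact (hgc.norm.mul hgc.norm).integrable_of_hasCompactSupport hgs.norm.mul_right
  have i3 : Integrable (fun x => φ x * (X x * fderiv ℝ φ x e)) :=
    (hφc.mul (X.continuous.mul hfe)).integrable_of_hasCompactSupport hc.mul_right
  -- The linear function `X` has derivative 1 along `e`; integrating `φ ∂ₑ(X φ)` by parts yields `∫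
  -- φ² = -2 ∫ φ X ∂ₑφ`.
  have ibp := integral_mul_fderiv_eq_neg_fderiv_mul_of_integrable (μ := volume) (f := φ)
    (g := fun x => X x * φ x) (v := e)
    ((hfe.mul (X.continuous.mul hφc)).integrable_of_hasCompactSupport hc.mul_left.mul_left)
    (by
      simp_rw [hder, mul_add]
      exact i3.add (by simpa [sq] using i1))
    ((hφc.mul (X.continuous.mul hφc)).integrable_of_hasCompactSupport hc.mul_right)
    (fun x _ => hφd x) (fun x _ => X.differentiableAt.mul (hφd x))
  have key : ∫ x, φ x ^ 2 = ∫ x, -2 * (φ x * (X x * fderiv ℝ φ x e)) := by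
    have h1 : ∫ x, φ x * fderiv ℝ (fun y => X y * φ y) x e
        = (∫ x, φ x * (X x * fderiv ℝ φ x e)) + ∫ x, φ x ^ 2 := by
      rw [← integral_add i3 i1]
      refine integral_congr_ae (Filter.Eventually.of_forall fun x => ?_)
      dsimp only
      rw [hder]
      ring
    have h2 : ∫ x, fderiv ℝ φ x e * (X x * φ x) = ∫ x, φ x * (X x * fderiv ℝ φ x e) := by
      refine integral_congr_ae (Filter.Eventually.of_forall fun x => ?_)
      dsimp only
      ring
    rw [integral_const_mul]
    linarith
  -- Young's inequality with `|X| ≤ R` on the support; the weight 1/2 lets the `φ²` term be absorbed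
  -- on the left, whence the constant `4 R²`.
  have hle : ∀ x, -2 * (φ x * (X x * fderiv ℝ φ x e))
      ≤ 1 / 2 * φ x ^ 2 + 2 * R ^ 2 * ‖gradient φ x‖ ^ 2 := by
    intro x
    by_cases hx : x ∈ tsupport φ
    · have h1 : |X x| ≤ R := (hX x).trans (by simpa using hs hx)
      have h2 : |fderiv ℝ φ x e| ≤ ‖gradient φ x‖ := by
        have := (fderiv ℝ φ x).le_opNorm e
        simpa [gradient, he] using this
      have h3 : |X x * fderiv ℝ φ x e| ≤ R * ‖gradient φ x‖ := by
        rw [abs_mul]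
        gcongr
        exact (abs_nonneg _).trans h1
      have h4 := sq_le_sq' (neg_le_of_abs_le h3) (le_of_abs_le h3)
      nlinarith [sq_nonneg (φ x + 2 * (X x * fderiv ℝ φ x e))]
    · rw [image_eq_zero_of_notMem_tsupport hx]
      simp only [zero_mul, mul_zero]
      positivity
  have h := integral_mono (i3.const_mul (-2)) ((i1.const_mul (1 / 2)).add (i2.const_mul (2 * R ^ 2)))
    hle
  rw [← key] at h
  simp only [Pi.add_apply] at h
  rw [integral_add (i1.const_mul _) (i2.const_mul _), integral_const_mul, integral_const_mul] at h
  linarith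

/-- The inequality is a closed condition, so test pairs suffice. Since `‖v‖²` includes the gradient
term, 1 is added to the constant for the function. -/
theorem H10.exists_poincare {d : ℕ} (hd : 0 < d) {Ω : Set (Euc d)}
    (hΩb : Bornology.IsBounded Ω) :
    ∃ C : ℝ, 0 < C ∧ ∀ v : H10 Ω, ‖v‖ ^ 2 ≤ C * ‖H10.grad v‖ ^ 2 := by
  have he : ‖(EuclideanSpace.single ⟨0, hd⟩ 1 : Euc d)‖ = 1 := by simp
  obtain ⟨R, hR⟩ := hΩb.subset_closedBall 0
  refine ⟨4 * R ^ 2 + 1, by positivity, ?_⟩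
  have hcl : IsClosed {p : L2Pair Ω | ‖p‖ ^ 2 ≤ (4 * R ^ 2 + 1) * ‖p.snd‖ ^ 2} :=
    isClosed_le (by fun_prop) (by fun_prop)
  have hsub : (testPairs Ω : Set (L2Pair Ω)) ⊆
      {p : L2Pair Ω | ‖p‖ ^ 2 ≤ (4 * R ^ 2 + 1) * ‖p.snd‖ ^ 2} := by
    rintro p ⟨φ, hφ, hc, hs, h1, h2⟩
    have h0 := integral_sq_le_of_tsupport_subset_ball he hφ hc (hs.trans hR)
    have e1 : ‖p.fst‖ ^ 2 = ∫ x, φ x ^ 2 := by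
      rw [norm_sq_eq_integral]
      refine Eq.trans ?_ (setIntegral_eq_integral_of_forall_compl_eq_zero (s := Ω) ?_)
      · refine integral_congr_ae ?_
        filter_upwards [h1] with x hx
        rw [hx, Real.norm_eq_abs, sq_abs]
      · intro x hx
        rw [image_eq_zero_of_notMem_tsupport fun h => hx (hs h)]
        simp
    have e2 : ‖p.snd‖ ^ 2 = ∫ x, ‖gradient φ x‖ ^ 2 := by
      rw [norm_sq_eq_integral]
      refine Eq.trans ?_ (setIntegral_eq_integral_of_forall_compl_eq_zero (s := Ω) ?_)
      · refine integral_congr_ae ?_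
        filter_upwards [h2] with x hx
        rw [hx]
      · intro x hx
        have : fderiv ℝ φ x = 0 :=
          image_eq_zero_of_notMem_tsupport fun h => hx (hs (tsupport_fderiv_subset ℝ h))
        simp [gradient, this]
    rw [Set.mem_ofPred_eq, WithLp.prod_norm_sq_eq_of_L2, e1, e2]
    linarith
  intro v
  exact closure_minimal hsub hcl v.2

/-! ### Multiplication by `1 / λ₋(θ)` as an operator on `L²`. -/

/-- The linear map `t ↦ 1 / λ₋(t)`. -/
noncomputable def invLamMinus {d N : ℕ} (M : Fin N → Matrix (Fin d) (Fin d) ℝ) :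
    (Fin N → ℝ) →L[ℝ] ℝ :=
  ∑ j, (minEig (M j))⁻¹ • ContinuousLinearMap.proj j

theorem invLamMinus_apply {d N : ℕ} (M : Fin N → Matrix (Fin d) (Fin d) ℝ) (t : Fin N → ℝ) :
    invLamMinus M t = ∑ j, t j / minEig (M j) := by
  simp [invLamMinus, div_eq_inv_mul]

theorem lamMinus_eq_inv {d N : ℕ} (M : Fin N → Matrix (Fin d) (Fin d) ℝ) (t : Fin N → ℝ) :
    lamMinus M t = (invLamMinus M t)⁻¹ := by
  rw [invLamMinus_apply, lamMinus]

theorem exists_pos_le_of_forall_pos {ι : Type*} [Finite ι] {c : ι → ℝ} (hc : ∀ j, 0 < c j) :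
    ∃ a, 0 < a ∧ ∀ j, a ≤ c j := by
  rcases isEmpty_or_nonempty ι with h | h
  · exact ⟨1, one_pos, fun j => (h.false j).elim⟩
  · obtain ⟨j, hj⟩ := Finite.exists_min c
    exact ⟨c j, hc j, hj⟩

theorem exists_bounds_invLamMinus {d N : ℕ} (hd : 0 < d) {M : Fin N → Matrix (Fin d) (Fin d) ℝ}
    (hM : ∀ j, (M j).PosDef) : ∃ a b : ℝ, 0 < a ∧ 0 < b ∧ ∀ t : Fin N → ℝ,
      (∀ j, t j ∈ Set.Icc (0 : ℝ) 1) → ∑ j, t j = 1 →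
        a ≤ invLamMinus M t ∧ invLamMinus M t ≤ b := by
  obtain ⟨a, ha, haj⟩ := exists_pos_le_of_forall_pos fun j => inv_pos.2 (minEig_pos hd (hM j))
  have hpos := fun j => inv_pos.2 (minEig_pos hd (hM j))
  -- The summand 1 keeps the upper bound positive when `N = 0`.
  refine ⟨a, 1 + ∑ j, (minEig (M j))⁻¹, ha,
    add_pos_of_pos_of_nonneg one_pos (Finset.sum_nonneg fun j _ => (hpos j).le),
    fun t ht hs => ?_⟩
  rw [invLamMinus_apply]
  constructor
  · calc a = ∑ j, t j * a := by rw [← Finset.sum_mul, hs, one_mul]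
      _ ≤ _ := Finset.sum_le_sum fun j _ => by
        rw [div_eq_mul_inv]
        exact mul_le_mul_of_nonneg_left (haj j) (ht j).1
  · calc ∑ j, t j / minEig (M j) ≤ ∑ j, (minEig (M j))⁻¹ :=
        Finset.sum_le_sum fun j _ => (div_eq_mul_inv _ _).trans_le
          (mul_le_of_le_one_left (hpos j).le (ht j).2)
      _ ≤ _ := by linarith

/-- Multiplication by a bounded function on `L²(Ω; ℝ^d)`. -/
noncomputable def mulL2 {d : ℕ} (Ω : Set (Euc d)) :
    Lp ℝ ∞ (lebOn Ω) →L[ℝ] L2Vec Ω →L[ℝ] L2Vec Ω :=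
  (ContinuousLinearMap.lsmul ℝ ℝ : ℝ →L[ℝ] Euc d →L[ℝ] Euc d).holderL (lebOn Ω) ∞ 2 2

theorem coeFn_mulL2 {d : ℕ} {Ω : Set (Euc d)} (a : Lp ℝ ∞ (lebOn Ω)) (g : L2Vec Ω) :
    (mulL2 Ω a g : Euc d → Euc d) =ᵐ[lebOn Ω] fun x => a x • g x := by
  have := (ContinuousLinearMap.lsmul ℝ ℝ : ℝ →L[ℝ] Euc d →L[ℝ] Euc d).coeFn_holder (r := 2) a g
  exact this

/-- Multiplication by `1 / λ₋(θ)` on `L²(Ω; ℝ^d)`. -/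
noncomputable def complianceOp {d N : ℕ} (Ω : Set (Euc d))
    (M : Fin N → Matrix (Fin d) (Fin d) ℝ) :
    Lp (Fin N → ℝ) ∞ (lebOn Ω) →L[ℝ] L2Vec Ω →L[ℝ] L2Vec Ω :=
  (mulL2 Ω).comp (ContinuousLinearMap.compLpL ∞ (lebOn Ω) (invLamMinus M))

theorem coeFn_complianceOp {d N : ℕ} {Ω : Set (Euc d)} (M : Fin N → Matrix (Fin d) (Fin d) ℝ)
    (θ : Lp (Fin N → ℝ) ∞ (lebOn Ω)) (g : L2Vec Ω) :
    (complianceOp Ω M θ g : Euc d → Euc d) =ᵐ[lebOn Ω] fun x => invLamMinus M (θ x) • g x := by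
  filter_upwards [coeFn_mulL2 ((invLamMinus M).compLpL ∞ (lebOn Ω) θ) g,
    (invLamMinus M).coeFn_compLpL θ] with x h1 h2
  rw [complianceOp, ContinuousLinearMap.comp_apply, h1, h2]

theorem mul_norm_sq_le_inner {α V : Type*} [MeasurableSpace α] {μ : Measure α}
    [NormedAddCommGroup V] [InnerProductSpace ℝ V] {c : ℝ} {h : α → ℝ} {G g : Lp V 2 μ}
    (hG : G =ᵐ[μ] fun x => h x • g x) (hc : ∀ᵐ x ∂μ, c ≤ h x) : c * ‖g‖ ^ 2 ≤ inner ℝ G g := by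
  rw [← real_inner_self_eq_norm_sq, L2.inner_def, L2.inner_def, ← integral_const_mul]
  refine integral_mono_ae ((L2.integrable_inner g g).const_mul c) (L2.integrable_inner G g) ?_
  filter_upwards [hG, hc] with x h1 h2
  rw [h1, real_inner_smul_left]
  exact mul_le_mul_of_nonneg_right h2 real_inner_self_nonneg

theorem inner_complianceOp_comm {d N : ℕ} {Ω : Set (Euc d)}
    (M : Fin N → Matrix (Fin d) (Fin d) ℝ) (θ : Lp (Fin N → ℝ) ∞ (lebOn Ω)) (g h : L2Vec Ω) :
    inner ℝ (complianceOp Ω M θ g) h = inner ℝ (complianceOp Ω M θ h) g := by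
  rw [L2.inner_def, L2.inner_def]
  refine integral_congr_ae ?_
  filter_upwards [coeFn_complianceOp M θ g, coeFn_complianceOp M θ h] with x h1 h2
  rw [h1, h2, real_inner_smul_left, real_inner_smul_left, real_inner_comm]

/-- Division by an inverse is multiplication even at zero, so this needs no admissibility of `θ`;
hence `H` is affine on the whole space. -/
theorem funH_eq_sum_inner {d N m : ℕ} {Ω : Set (Euc d)} (M : Fin N → Matrix (Fin d) (Fin d) ℝ)
    (w : Fin m → ℝ) (θ : Lp (Fin N → ℝ) ∞ (lebOn Ω)) (σ : Fin m → L2Vec Ω) :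
    funH M w θ σ = ∑ i, w i * inner ℝ (complianceOp Ω M θ (σ i)) (σ i) := by
  refine Finset.sum_congr rfl fun i _ => ?_
  rw [L2.inner_def]
  congr 1
  refine integral_congr_ae ?_
  filter_upwards [coeFn_complianceOp M θ (σ i)] with x h1
  rw [h1, real_inner_smul_left, real_inner_self_eq_norm_sq, lamMinus_eq_inv, div_inv_eq_mul,
    mul_comm]

theorem mem_fluxes_iff {d m : ℕ} {Ω : Set (Euc d)} {f : Fin m → HNeg1 Ω}
    {σ : Fin m → L2Vec Ω} :
    σ ∈ fluxes f ↔ ∀ i, ∀ v : H10 Ω, inner ℝ (σ i) (H10.grad v) = f i v := by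
  simp only [L2.inner_def]
  rfl

/-- The inverse of multiplication by `1 / λ₋(θ)`, for an admissible `θ`. -/
theorem exists_inverse_complianceOp {d N : ℕ} (hd : 0 < d) {Ω : Set (Euc d)}
    {M : Fin N → Matrix (Fin d) (Fin d) ℝ} (hM : ∀ j, (M j).PosDef) {q : Fin N → ℝ}
    {θ : Lp (Fin N → ℝ) ∞ (lebOn Ω)} (hθ : θ ∈ designs Ω q) :
    ∃ L : L2Vec Ω →L[ℝ] L2Vec Ω, (∃ c : ℝ, 0 < c ∧ ∀ g, c * ‖g‖ ^ 2 ≤ inner ℝ (L g) g) ∧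
      (∀ g, (L g : Euc d → Euc d) =ᵐ[lebOn Ω] fun x => lamMinus M (θ x) • g x) ∧
      ∀ g, complianceOp Ω M θ (L g) = g := by
  obtain ⟨a, b, ha, hb, hab⟩ := exists_bounds_invLamMinus hd hM
  have hmem : MemLp (fun x => lamMinus M (θ x)) ∞ (lebOn Ω) := by
    refine memLp_top_of_bound ?_ a⁻¹ ?_
    · simp_rw [lamMinus_eq_inv]
      exact ((invLamMinus M).continuous.comp_aestronglyMeasurable
        (Lp.aestronglyMeasurable θ)).aemeasurable.inv.aestronglyMeasurable
    · filter_upwards [hθ.1] with x hx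
      have h1 := (hab _ hx.1 hx.2).1
      rw [lamMinus_eq_inv, norm_inv, Real.norm_of_nonneg (ha.le.trans h1)]
      exact inv_anti₀ ha h1
  have hL : ∀ g, (mulL2 Ω hmem.toLp g : Euc d → Euc d)
      =ᵐ[lebOn Ω] fun x => lamMinus M (θ x) • g x := fun g => by
    filter_upwards [coeFn_mulL2 hmem.toLp g, hmem.coeFn_toLp] with x h1 h2
    rw [h1, h2]
  refine ⟨mulL2 Ω hmem.toLp, ⟨b⁻¹, inv_pos.2 hb, fun g => mul_norm_sq_le_inner (hL g) ?_⟩, hL,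
    fun g => ?_⟩
  · filter_upwards [hθ.1] with x hx
    have h1 := hab _ hx.1 hx.2
    rw [lamMinus_eq_inv]
    exact inv_anti₀ (ha.trans_le h1.1) h1.2
  · apply Lp.ext
    filter_upwards [coeFn_complianceOp M θ (mulL2 Ω hmem.toLp g), hL g, hθ.1] with x h1 h2 hx
    have h3 := ha.trans_le (hab _ hx.1 hx.2).1
    rw [h1, h2, smul_smul, lamMinus_eq_inv, mul_inv_cancel₀ h3.ne', one_smul]

/-! ### The state problem and its flux. -/

/-- The weak gradient as a continuous linear map. -/
noncomputable def H10.gradL {d : ℕ} (Ω : Set (Euc d)) : H10 Ω →L[ℝ] L2Vec Ω :=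
  (WithLp.sndL 2 ℝ _ _).comp (H10 Ω).subtypeL

theorem isState_iff_of_ae {d N : ℕ} {Ω : Set (Euc d)} {M : Fin N → Matrix (Fin d) (Fin d) ℝ}
    {θ : Lp (Fin N → ℝ) ∞ (lebOn Ω)} {g : HNeg1 Ω} {u : H10 Ω} {G : L2Vec Ω}
    (hG : (G : Euc d → Euc d) =ᵐ[lebOn Ω] fun x => lamMinus M (θ x) • H10.grad u x) :
    IsState M θ g u ↔ ∀ v : H10 Ω, inner ℝ G (H10.grad v) = g v := by
  refine forall_congr' fun v => ?_
  rw [L2.inner_def]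
  refine Eq.congr_left (integral_congr_ae ?_)
  filter_upwards [hG] with x hx
  rw [hx, real_inner_smul_left]

/-- Lax–Milgram: a positive lower bound on `λ₋(θ)` and the Poincaré inequality make the bilinear
form coercive. -/
theorem existsUnique_isState {d N : ℕ} (hd : 0 < d) {Ω : Set (Euc d)}
    (hΩb : Bornology.IsBounded Ω) {M : Fin N → Matrix (Fin d) (Fin d) ℝ}
    (hM : ∀ j, (M j).PosDef) {q : Fin N → ℝ} {θ : Lp (Fin N → ℝ) ∞ (lebOn Ω)}
    (hθ : θ ∈ designs Ω q) (g : HNeg1 Ω) : ∃! u : H10 Ω, IsState M θ g u := by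
  obtain ⟨L, ⟨c, hc, hcL⟩, hL, -⟩ := exists_inverse_complianceOp hd hM hθ
  obtain ⟨C, hC, hP⟩ := H10.exists_poincare hd hΩb
  have : CompleteSpace (H10 Ω) :=
    (Submodule.isClosed_topologicalClosure (testPairs Ω)).completeSpace_coe
  let B : H10 Ω →L[ℝ] H10 Ω →L[ℝ] ℝ :=
    ((innerSL ℝ : L2Vec Ω →L[ℝ] L2Vec Ω →L[ℝ] ℝ)).bilinearComp (L.comp (H10.gradL Ω)) (H10.gradL Ω)
  have hB : ∀ u v, B u v = inner ℝ (L (H10.grad u)) (H10.grad v) := fun u v => rfl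
  have hco : IsCoercive B := by
    refine ⟨c / C, by positivity, fun u => ?_⟩
    rw [hB]
    refine le_trans ?_ (hcL _)
    rw [mul_assoc, ← sq, div_mul_eq_mul_div, div_le_iff₀ hC, mul_assoc]
    gcongr
    rw [mul_comm]
    exact hP u
  have hiff : ∀ u, IsState M θ g u ↔
      hco.continuousLinearEquivOfBilin u = (InnerProductSpace.toDual ℝ (H10 Ω)).symm g := by
    intro u
    rw [isState_iff_of_ae (hL _)]
    constructor
    · intro h
      refine ext_inner_right ℝ fun v => ?_
      rw [hco.continuousLinearEquivOfBilin_apply, InnerProductSpace.toDual_symm_apply, hB, h]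
    · intro h v
      rw [← hB, ← hco.continuousLinearEquivOfBilin_apply, h, InnerProductSpace.toDual_symm_apply]
  refine ⟨hco.continuousLinearEquivOfBilin.symm ((InnerProductSpace.toDual ℝ (H10 Ω)).symm g),
    (hiff _).2 (by simp), fun u hu => ?_⟩
  rw [← (hiff u).1 hu, ContinuousLinearEquiv.symm_apply_apply]

/-- The flux `λ₋(θ) ∇u` of the states. -/
theorem exists_flux_of_design {d N m : ℕ} (hd : 0 < d) {Ω : Set (Euc d)}
    (hΩb : Bornology.IsBounded Ω) {M : Fin N → Matrix (Fin d) (Fin d) ℝ}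
    (hM : ∀ j, (M j).PosDef) {q : Fin N → ℝ} {θ : Lp (Fin N → ℝ) ∞ (lebOn Ω)}
    (hθ : θ ∈ designs Ω q) (f : Fin m → HNeg1 Ω) :
    ∃ τ ∈ fluxes f, ∀ i, complianceOp Ω M θ (τ i) = H10.grad (state M θ (f i)) := by
  obtain ⟨L, -, hL, hAL⟩ := exists_inverse_complianceOp hd hM hθ
  refine ⟨fun i => L (H10.grad (state M θ (f i))), mem_fluxes_iff.2 fun i => ?_, fun i => hAL _⟩
  exact (isState_iff_of_ae (hL _)).1
    (Classical.epsilon_spec (existsUnique_isState hd hΩb hM hθ (f i)).exists)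

/-! ### `H` as a quadratic function of the flux and an affine function of the design. -/

/-- Expand the quadratic form around `τ`. Its image under the compliance operator is the gradient of
the state, against which all fluxes integrate to the same value, so the linear term vanishes. -/
theorem funH_eq_energyI_add {d N m : ℕ} {Ω : Set (Euc d)}
    {M : Fin N → Matrix (Fin d) (Fin d) ℝ} {w : Fin m → ℝ} {f : Fin m → HNeg1 Ω}
    {θ : Lp (Fin N → ℝ) ∞ (lebOn Ω)} {τ σ : Fin m → L2Vec Ω} (hτ : τ ∈ fluxes f)
    (hτθ : ∀ i, complianceOp Ω M θ (τ i) = H10.grad (state M θ (f i))) (hσ : σ ∈ fluxes f) :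
    funH M w θ σ = energyI M w f θ +
      ∑ i, w i * inner ℝ (complianceOp Ω M θ (σ i - τ i)) (σ i - τ i) := by
  rw [funH_eq_sum_inner, energyI, ← Finset.sum_add_distrib]
  refine Finset.sum_congr rfl fun i _ => ?_
  have h1 := mem_fluxes_iff.1 hτ i (state M θ (f i))
  have h2 := mem_fluxes_iff.1 hσ i (state M θ (f i))
  rw [← hτθ, real_inner_comm] at h1 h2
  have h3 := inner_complianceOp_comm M θ (σ i) (τ i)
  rw [map_sub, inner_sub_left, inner_sub_right, inner_sub_right]
  linear_combination w i * h3 + 2 * w i * h2 - w i * h1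

/-- The lower bounds on `1 / λ₋` and on the weights do not involve `θ`, so one `κ` serves all
designs. The norm of `σ - τ` is a maximum over `i`, so each single summand is compared with the
whole sum. -/
theorem energyI_add_le_funH {d N m : ℕ} (hd : 0 < d) (Ω : Set (Euc d))
    {M : Fin N → Matrix (Fin d) (Fin d) ℝ} (hM : ∀ j, (M j).PosDef) (q : Fin N → ℝ)
    {w : Fin m → ℝ} (hw : ∀ i, 0 < w i) (f : Fin m → HNeg1 Ω) :
    ∃ κ : ℝ, 0 < κ ∧ ∀ θ ∈ designs Ω q, ∀ τ ∈ fluxes f,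
      (∀ i, complianceOp Ω M θ (τ i) = H10.grad (state M θ (f i))) → ∀ σ ∈ fluxes f,
        energyI M w f θ + κ * ‖σ - τ‖ ^ 2 ≤ funH M w θ σ := by
  obtain ⟨a, b, ha, -, hab⟩ := exists_bounds_invLamMinus hd hM
  obtain ⟨c, hc, hcw⟩ := exists_pos_le_of_forall_pos hw
  refine ⟨c * a, by positivity, fun θ hθ τ hτ hτθ σ hσ => ?_⟩
  rw [funH_eq_energyI_add hτ hτθ hσ, add_le_add_iff_left]
  have hterm : ∀ i, c * a * ‖σ i - τ i‖ ^ 2 ≤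
      w i * inner ℝ (complianceOp Ω M θ (σ i - τ i)) (σ i - τ i) := fun i => by
    rw [mul_assoc]
    refine mul_le_mul (hcw i) (mul_norm_sq_le_inner (coeFn_complianceOp M θ _) ?_)
      (by positivity) (hw i).le
    filter_upwards [hθ.1] with x hx using (hab _ hx.1 hx.2).1
  have h0 : ∀ i ∈ Finset.univ,
      0 ≤ w i * inner ℝ (complianceOp Ω M θ (σ i - τ i)) (σ i - τ i) :=
    fun i _ => le_trans (by positivity) (hterm i)
  have hsum := fun i => (hterm i).trans (Finset.single_le_sum h0 (Finset.mem_univ i))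
  have hnorm : ‖σ - τ‖ ≤ √((∑ i, w i * inner ℝ (complianceOp Ω M θ (σ i - τ i)) (σ i - τ i))
      / (c * a)) := by
    refine (pi_norm_le_iff_of_nonneg (Real.sqrt_nonneg _)).2 fun i => Real.le_sqrt_of_sq_le ?_
    rw [le_div_iff₀' (by positivity)]
    exact hsum i
  rw [← le_div_iff₀' (by positivity)]
  exact (Real.le_sqrt (norm_nonneg _) (div_nonneg (Finset.sum_nonneg h0) (by positivity))).1 hnorm

theorem inner_le_mul_norm_sq {α V : Type*} [MeasurableSpace α] {μ : Measure α}
    [NormedAddCommGroup V] [InnerProductSpace ℝ V] {c : ℝ} {h : α → ℝ} {G g : Lp V 2 μ}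
    (hG : G =ᵐ[μ] fun x => h x • g x) (hc : ∀ᵐ x ∂μ, h x ≤ c) : inner ℝ G g ≤ c * ‖g‖ ^ 2 := by
  rw [← real_inner_self_eq_norm_sq, L2.inner_def, L2.inner_def, ← integral_const_mul]
  refine integral_mono_ae (L2.integrable_inner G g) ((L2.integrable_inner g g).const_mul c) ?_
  filter_upwards [hG, hc] with x h1 h2
  rw [h1, real_inner_smul_left]
  exact mul_le_mul_of_nonneg_right h2 real_inner_self_nonneg

theorem funH_affine {d N m : ℕ} {Ω : Set (Euc d)} (M : Fin N → Matrix (Fin d) (Fin d) ℝ)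
    (w : Fin m → ℝ) (θ θ' : Lp (Fin N → ℝ) ∞ (lebOn Ω)) (σ : Fin m → L2Vec Ω) (r : ℝ) :
    funH M w ((1 - r) • θ + r • θ') σ = (1 - r) * funH M w θ σ + r * funH M w θ' σ := by
  simp only [funH_eq_sum_inner, Finset.mul_sum, ← Finset.sum_add_distrib]
  refine Finset.sum_congr rfl fun i _ => ?_
  rw [map_add, map_smul, map_smul, add_apply, smul_apply, smul_apply, inner_add_left,
    real_inner_smul_left, real_inner_smul_left]
  ring

theorem continuous_funH {d N m : ℕ} {Ω : Set (Euc d)} (M : Fin N → Matrix (Fin d) (Fin d) ℝ)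
    (w : Fin m → ℝ) (θ : Lp (Fin N → ℝ) ∞ (lebOn Ω)) : Continuous (funH (Ω := Ω) M w θ) := by
  have : funH (Ω := Ω) M w θ =
      fun σ => ∑ i, w i * inner ℝ (complianceOp Ω M θ (σ i)) (σ i) :=
    funext fun σ => funH_eq_sum_inner M w θ σ
  rw [this]
  fun_prop

theorem funH_le_of_mem_designs {d N m : ℕ} (hd : 0 < d) {Ω : Set (Euc d)}
    {M : Fin N → Matrix (Fin d) (Fin d) ℝ} (hM : ∀ j, (M j).PosDef) (q : Fin N → ℝ)
    {w : Fin m → ℝ} (hw : ∀ i, 0 < w i) (σ : Fin m → L2Vec Ω) :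
    ∃ B : ℝ, ∀ θ ∈ designs Ω q, funH M w θ σ ≤ B := by
  obtain ⟨a, b, -, -, hab⟩ := exists_bounds_invLamMinus hd hM
  refine ⟨∑ i, w i * (b * ‖σ i‖ ^ 2), fun θ hθ => ?_⟩
  rw [funH_eq_sum_inner]
  refine Finset.sum_le_sum fun i _ => mul_le_mul_of_nonneg_left
    (inner_le_mul_norm_sq (coeFn_complianceOp M θ _) ?_) (hw i).le
  filter_upwards [hθ.1] with x hx using (hab _ hx.1 hx.2).2

/-! ### The set of designs: convexity, nonemptiness, weak-* compactness. -/

theorem integrable_design_apply {d N : ℕ} {Ω : Set (Euc d)} [IsFiniteMeasure (lebOn Ω)]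
    (θ : Lp (Fin N → ℝ) ∞ (lebOn Ω)) (j : Fin N) : Integrable (fun x => θ x j) (lebOn Ω) :=
  ((Lp.memLp θ).integrable (by simp)).eval j

theorem convex_designs {d N : ℕ} (Ω : Set (Euc d)) [IsFiniteMeasure (lebOn Ω)] (q : Fin N → ℝ) :
    Convex ℝ (designs Ω q) := by
  rintro θ ⟨h1, h2⟩ θ' ⟨h1', h2'⟩ a b ha hb hab
  have hco : (a • θ + b • θ' : Lp (Fin N → ℝ) ∞ (lebOn Ω)) =ᵐ[lebOn Ω]
      fun x => a • θ x + b • θ' x := by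
    filter_upwards [Lp.coeFn_add (a • θ) (b • θ'), Lp.coeFn_smul a θ, Lp.coeFn_smul b θ']
      with x k1 k2 k3
    rw [k1, Pi.add_apply, k2, k3]
    rfl
  refine ⟨?_, fun j => ?_⟩
  · filter_upwards [hco, h1, h1'] with x k1 k2 k3
    rw [k1]
    refine ⟨fun j => convex_Icc (0 : ℝ) 1 (k2.1 j) (k3.1 j) ha hb hab, ?_⟩
    simp only [Pi.add_apply, Pi.smul_apply, smul_eq_mul, Finset.sum_add_distrib,
      ← Finset.mul_sum, k2.2, k3.2, mul_one, hab]
  · have : ∫ x in Ω, (a • θ + b • θ' : Lp (Fin N → ℝ) ∞ (lebOn Ω)) x j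
        = ∫ x in Ω, (a * θ x j + b * θ' x j) := by
      refine integral_congr_ae ?_
      filter_upwards [hco] with x k1
      rw [k1]
      rfl
    rw [this, integral_add ((integrable_design_apply θ j).const_mul a)
      ((integrable_design_apply θ' j).const_mul b), integral_const_mul, integral_const_mul, h2, h2',
      ← add_mul, hab, one_mul]

/-- The constant design `q j / |Ω|` works. If `|Ω| = 0`, all `q j` vanish and the pointwise
constraints are void. -/
theorem designs_nonempty {d N : ℕ} {Ω : Set (Euc d)} [IsFiniteMeasure (lebOn Ω)] {q : Fin N → ℝ}
    (hq : ∀ j, 0 ≤ q j) (hqsum : ∑ j, q j = volume.real Ω) : (designs Ω q).Nonempty := by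
  have hmem : MemLp (fun _ : Euc d => fun j => q j / volume.real Ω) ∞ (lebOn Ω) := memLp_const _
  refine ⟨hmem.toLp, ?_, fun j => ?_⟩
  · rcases eq_or_ne (lebOn Ω) 0 with h0 | h0
    · rw [Filter.Eventually, ae_eq_bot.2 h0]
      exact Filter.mem_bot
    · have hpos : 0 < volume.real Ω := by
        refine ENNReal.toReal_pos (fun h => h0 (Measure.restrict_eq_zero.2 h)) ?_
        simpa using measure_ne_top (lebOn Ω) Set.univ
      filter_upwards [hmem.coeFn_toLp] with x hx
      rw [hx]
      refine ⟨fun j => ⟨by have := hq j; positivity, ?_⟩, ?_⟩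
      · rw [div_le_one hpos, ← hqsum]
        exact Finset.single_le_sum (fun j _ => hq j) (Finset.mem_univ j)
      · rw [← Finset.sum_div, hqsum, div_self hpos.ne']
  · have : ∫ x in Ω, (hmem.toLp : Lp (Fin N → ℝ) ∞ (lebOn Ω)) x j
        = ∫ x in Ω, q j / volume.real Ω := by
      refine integral_congr_ae ?_
      filter_upwards [hmem.coeFn_toLp] with x hx
      rw [hx]
    rw [this, setIntegral_const, smul_eq_mul]
    rcases eq_or_ne (volume.real Ω) 0 with h0 | h0
    · have : q j ≤ 0 := by
        rw [← h0, ← hqsum]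
        exact Finset.single_le_sum (fun j _ => hq j) (Finset.mem_univ j)
      rw [h0, zero_mul]
      exact le_antisymm (hq j) this
    · rw [mul_div_cancel₀ _ h0]

/-- The density against which `θ` is integrated in `H(θ, σ)`. -/
noncomputable def energyDensity {d N m : ℕ} {Ω : Set (Euc d)}
    (M : Fin N → Matrix (Fin d) (Fin d) ℝ) (w : Fin m → ℝ) (σ : Fin m → L2Vec Ω) (x : Euc d) :
    Euc N :=
  WithLp.toLp 2 fun j => ∑ i, w i * ‖σ i x‖ ^ 2 / minEig (M j)

theorem integrable_energyDensity {d N m : ℕ} {Ω : Set (Euc d)}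
    (M : Fin N → Matrix (Fin d) (Fin d) ℝ) (w : Fin m → ℝ) (σ : Fin m → L2Vec Ω) :
    Integrable (energyDensity M w σ) (lebOn Ω) := by
  refine Integrable.of_eval_piLp fun j => ?_
  have h : ∀ i, Integrable (fun x => ‖σ i x‖ ^ 2) (lebOn Ω) := fun i => by
    simpa using L2.integrable_inner (𝕜 := ℝ) (σ i) (σ i)
  change Integrable (fun x => ∑ i, w i * ‖σ i x‖ ^ 2 / minEig (M j)) (lebOn Ω)
  exact integrable_finsetSum _ fun i _ => ((h i).const_mul (w i)).div_const (minEig (M j))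

theorem funH_eq_integral_inner {d N m : ℕ} {Ω : Set (Euc d)}
    (M : Fin N → Matrix (Fin d) (Fin d) ℝ) (w : Fin m → ℝ) (θ : Lp (Fin N → ℝ) ∞ (lebOn Ω))
    (σ : Fin m → L2Vec Ω) :
    funH M w θ σ = ∫ x in Ω, inner ℝ (WithLp.toLp 2 (θ x) : Euc N) (energyDensity M w σ x) := by
  rw [funH_eq_sum_inner]
  simp_rw [L2.inner_def, ← integral_const_mul]
  rw [← integral_finsetSum _ fun i _ => (L2.integrable_inner _ _).const_mul _]
  refine integral_congr_ae ?_
  filter_upwards [ae_all_iff.2 fun i => coeFn_complianceOp M θ (σ i)] with x hx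
  simp only [hx, real_inner_smul_left, real_inner_self_eq_norm_sq, invLamMinus_apply]
  simp only [energyDensity, PiLp.inner_apply, RCLike.inner_apply, conj_trivial, Finset.sum_mul,
    Finset.mul_sum]
  rw [Finset.sum_comm]
  refine Finset.sum_congr rfl fun j _ => Finset.sum_congr rfl fun i _ => ?_
  ring

/-- The designs are sequentially weak-* compact, in the form needed for functionals that are bounded
below along a sequence. -/
theorem exists_design_cluster {d N : ℕ} {Ω : Set (Euc d)} [IsFiniteMeasure (lebOn Ω)]
    {q : Fin N → ℝ} {η : ℕ → Lp (Fin N → ℝ) ∞ (lebOn Ω)} (hη : ∀ n, η n ∈ designs Ω q) :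
    ∃ θ ∈ designs Ω q, ∀ h : Euc d → Euc N, Integrable h (lebOn Ω) → ∀ c : ℝ,
      (∀ᶠ n in Filter.atTop, c ≤ ∫ x in Ω, inner ℝ (WithLp.toLp 2 (η n x) : Euc N) (h x)) →
        c ≤ ∫ x in Ω, inner ℝ (WithLp.toLp 2 (θ x) : Euc N) (h x) := by
  let K : Set (Euc N) := {t | (∀ j, t j ∈ Set.Icc (0 : ℝ) 1) ∧ ∑ j, t j = 1}
  have hKc : IsClosed K := by
    have h1 : IsClosed (⋂ j, {t : Euc N | t j ∈ Set.Icc (0 : ℝ) 1}) :=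
      isClosed_iInter fun j => isClosed_Icc.preimage (by fun_prop)
    have h2 : IsClosed {t : Euc N | ∑ j, t j = 1} := isClosed_eq (by fun_prop) continuous_const
    convert h1.inter h2 using 1
    ext t
    simp [K]
  have hKv : Convex ℝ K := by
    rintro s ⟨h1, h2⟩ t ⟨k1, k2⟩ a b ha hb hab
    refine ⟨fun j => convex_Icc (0 : ℝ) 1 (h1 j) (k1 j) ha hb hab, ?_⟩
    simp only [PiLp.add_apply, PiLp.smul_apply, smul_eq_mul, Finset.sum_add_distrib,
      ← Finset.mul_sum, h2, k2, mul_one, hab]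
  have hKb : ∀ t ∈ K, ‖t‖ ≤ 1 := by
    rintro t ⟨h1, h2⟩
    rw [EuclideanSpace.norm_eq, Real.sqrt_le_one, ← h2]
    refine Finset.sum_le_sum fun j _ => ?_
    rw [Real.norm_eq_abs, sq_abs, sq]
    exact mul_le_of_le_one_left (h1 j).1 (h1 j).2
  obtain ⟨ψ, hψm, hψK, hψ⟩ := exists_weak_cluster (μ := lebOn Ω) hKc hKv hKb
    (g := fun n x => WithLp.toLp 2 (η n x))
    (fun n => (PiLp.continuous_toLp 2 _).comp_aestronglyMeasurable (Lp.aestronglyMeasurable (η n)))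
    (fun n => (hη n).1)
  have hmem : MemLp (fun x => WithLp.ofLp (ψ x)) ∞ (lebOn Ω) := by
    refine memLp_top_of_bound ((PiLp.continuous_ofLp 2 _).comp_aestronglyMeasurable hψm) 1 ?_
    filter_upwards [hψK] with x hx
    refine (pi_norm_le_iff_of_nonneg zero_le_one).2 fun j => ?_
    rw [Real.norm_of_nonneg (hx.1 j).1]
    exact (hx.1 j).2
  have hψθ := hmem.coeFn_toLp
  have hint : ∀ h : Euc d → Euc N, ∫ x in Ω, inner ℝ (WithLp.toLp 2
      ((hmem.toLp : Lp (Fin N → ℝ) ∞ (lebOn Ω)) x) : Euc N) (h x)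
        = ∫ x in Ω, inner ℝ (ψ x) (h x) := fun h => by
    refine integral_congr_ae ?_
    filter_upwards [hψθ] with x hx
    rw [hx]
  refine ⟨hmem.toLp, ⟨?_, fun j => ?_⟩, fun h hh c hc => ?_⟩
  · filter_upwards [hψθ, hψK] with x h1 h2
    rw [h1]
    exact h2
  · have e1 : ∫ x in Ω, (hmem.toLp : Lp (Fin N → ℝ) ∞ (lebOn Ω)) x j = ∫ x in Ω, ψ x j := by
      refine integral_congr_ae ?_
      filter_upwards [hψθ] with x hx
      rw [hx]
    rw [e1]
    -- Testing with both signs turns the one-sided estimates into the equality of the integrals.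
    have h1 := hψ (fun _ => EuclideanSpace.single j 1) (integrable_const _) (q j)
      (Filter.Eventually.of_forall fun n => by
        simp [EuclideanSpace.inner_single_right, (hη n).2 j])
    have h2 := hψ (fun _ => EuclideanSpace.single j (-1)) (integrable_const _) (-q j)
      (Filter.Eventually.of_forall fun n => by
        simp [EuclideanSpace.inner_single_right, integral_neg, (hη n).2 j])
    simp only [EuclideanSpace.inner_single_right, conj_trivial, one_mul, neg_mul,
      integral_neg] at h1 h2
    linarith
  · rw [hint]
    exact hψ h hh c hc

/-! ### Existence of maximizers and the saddle point theorem. -/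

theorem exists_isMax_energyI {d N m : ℕ} (hd : 0 < d) {Ω : Set (Euc d)}
    [IsFiniteMeasure (lebOn Ω)] (hΩb : Bornology.IsBounded Ω)
    {M : Fin N → Matrix (Fin d) (Fin d) ℝ} (hM : ∀ j, (M j).PosDef)
    {q : Fin N → ℝ} (hne : (designs Ω q).Nonempty) {w : Fin m → ℝ} (hw : ∀ i, 0 < w i)
    (f : Fin m → HNeg1 Ω) :
    ∃ θ ∈ designs Ω q, ∀ θ' ∈ designs Ω q, energyI M w f θ' ≤ energyI M w f θ := by
  obtain ⟨κ, hκ, hmin⟩ := energyI_add_le_funH hd Ω hM q hw f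
  have hle : ∀ θ ∈ designs Ω q, ∀ σ ∈ fluxes f, energyI M w f θ ≤ funH M w θ σ := by
    intro θ hθ σ hσ
    obtain ⟨τ, hτ, hτθ⟩ := exists_flux_of_design hd hΩb hM hθ f
    exact (le_add_of_nonneg_right (by positivity)).trans (hmin θ hθ τ hτ hτθ σ hσ)
  obtain ⟨θ₀, hθ₀⟩ := hne
  obtain ⟨τ₀, hτ₀, -⟩ := exists_flux_of_design hd hΩb hM hθ₀ f
  obtain ⟨B, hB⟩ := funH_le_of_mem_designs hd hM q hw τ₀
  have hbdd : BddAbove (energyI M w f '' designs Ω q) := by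
    refine ⟨B, ?_⟩
    rintro _ ⟨θ, hθ, rfl⟩
    exact (hle θ hθ τ₀ hτ₀).trans (hB θ hθ)
  obtain ⟨u, -, hu, hmem⟩ := exists_seq_tendsto_sSup (Set.Nonempty.image _ ⟨θ₀, hθ₀⟩) hbdd
  choose η hη hηu using hmem
  obtain ⟨θ, hθ, hθc⟩ := exists_design_cluster hη
  refine ⟨θ, hθ, fun θ' hθ' => (le_csSup hbdd ⟨θ', hθ', rfl⟩).trans ?_⟩
  obtain ⟨τ, hτ, hτθ⟩ := exists_flux_of_design hd hΩb hM hθ f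
  have hval : funH M w θ τ = energyI M w f θ := by simp [funH_eq_energyI_add hτ hτθ hτ]
  -- Upper semicontinuity: with the flux `τ` of the limit design held fixed, `c < I(η n) ≤ H(η n,
  -- τ)` eventually, and this lower bound passes to `H(θ, τ) = I(θ)`.
  refine le_of_forall_lt_imp_le_of_dense fun c hc => ?_
  rw [← hval, funH_eq_integral_inner]
  refine hθc _ (integrable_energyDensity M w τ) c ?_
  filter_upwards [hu.eventually_const_lt hc] with n hn
  rw [← funH_eq_integral_inner]
  exact (hn.le.trans_eq (hηu n).symm).trans (hle _ (hη n) τ hτ)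

theorem lemma3p2 {d N m : ℕ} (hd : 0 < d) (Ω : Set (Euc d)) (hΩo : IsOpen Ω)
    (hΩb : Bornology.IsBounded Ω)
    (M : Fin N → Matrix (Fin d) (Fin d) ℝ) (hM : ∀ j, (M j).PosDef)
    (q : Fin N → ℝ) (hq : ∀ j, 0 ≤ q j) (hqsum : ∑ j, q j = volume.real Ω)
    (w : Fin m → ℝ) (hw : ∀ i, 0 < w i) (f : Fin m → HNeg1 Ω) :
    -- the state problems are uniquely solvable, so that `energyI` is the energy of the solutions
    (∀ θ ∈ designs Ω q, ∀ i, ∃! u : H10 Ω, IsState M θ (f i) u) ∧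
    -- saddle points exist, and they all have the same second component
    (∃ σs ∈ fluxes f, (optDesigns M q w f).Nonempty ∧
      saddlePoints M q w f = optDesigns M q w f ×ˢ {σs}) ∧
    -- the maximizers of the energy are the first components of the saddle points
    {θ | θ ∈ designs Ω q ∧ ∀ θ' ∈ designs Ω q, energyI M w f θ' ≤ energyI M w f θ} =
      optDesigns M q w f := by
  have : IsFiniteMeasure (lebOn Ω) := ⟨by simpa using hΩb.measure_lt_top⟩
  refine ⟨fun θ hθ i => existsUnique_isState hd hΩb hM hθ (f i), ?_⟩
  obtain ⟨κ, hκ, hmin⟩ := energyI_add_le_funH hd Ω hM q hw f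
  have hflux : ∀ θ, ∃ τ : Fin m → L2Vec Ω, θ ∈ designs Ω q → τ ∈ fluxes f ∧
      ∀ i, complianceOp Ω M θ (τ i) = H10.grad (state M θ (f i)) := by
    intro θ
    by_cases hθ : θ ∈ designs Ω q
    · obtain ⟨τ, h1, h2⟩ := exists_flux_of_design hd hΩb hM hθ f
      exact ⟨τ, fun _ => ⟨h1, h2⟩⟩
    · exact ⟨0, fun h => (hθ h).elim⟩
  choose s hs using hflux
  have hval : ∀ θ ∈ designs Ω q, funH M w θ (s θ) = energyI M w f θ := fun θ hθ => by
    simp [funH_eq_energyI_add (hs θ hθ).1 (hs θ hθ).2 (hs θ hθ).1]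
  have hmin' : ∀ θ ∈ designs Ω q, ∀ σ ∈ fluxes f,
      energyI M w f θ + κ * ‖σ - s θ‖ ^ 2 ≤ funH M w θ σ := fun θ hθ =>
    hmin θ hθ (s θ) (hs θ hθ).1 (hs θ hθ).2
  have heq : ∀ θ ∈ designs Ω q, ∀ σ ∈ fluxes f, funH M w θ σ ≤ energyI M w f θ → σ = s θ := by
    intro θ hθ σ hσ h
    have h1 := hmin' θ hθ σ hσ
    have h2 : ‖σ - s θ‖ ^ 2 ≤ 0 := by
      by_contra hc
      have := mul_pos hκ (not_le.1 hc)
      linarith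
    have h3 : ‖σ - s θ‖ = 0 := by
      have := sq_nonneg ‖σ - s θ‖
      exact pow_eq_zero_iff two_ne_zero |>.1 (le_antisymm h2 this)
    exact sub_eq_zero.1 (norm_eq_zero.1 h3)
  have hsad : ∀ p ∈ saddlePoints M q w f, p.2 = s p.1 := fun p hp =>
    heq p.1 hp.1 p.2 hp.2.1 ((hp.2.2.2 _ (hs _ hp.1).1).trans_eq (hval _ hp.1))
  have hmax : ∀ p ∈ saddlePoints M q w f, ∀ θ' ∈ designs Ω q,
      energyI M w f θ' + κ * ‖p.2 - s θ'‖ ^ 2 ≤ energyI M w f p.1 := fun p hp θ' hθ' => by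
    refine ((hmin' θ' hθ' p.2 hp.2.1).trans (hp.2.2.1 θ' hθ')).trans_eq ?_
    rw [hsad p hp, hval _ hp.1]
  have hmk : ∀ θ ∈ designs Ω q, (∀ θ' ∈ designs Ω q, energyI M w f θ' ≤ energyI M w f θ) →
      (θ, s θ) ∈ saddlePoints M q w f := by
    intro θ hθ hm
    refine ⟨hθ, (hs θ hθ).1, fun θ' hθ' => ?_, fun σ hσ => ?_⟩
    · exact isSaddle_of_isMax (convex_designs Ω q) hκ (fun θ θ' σ r => funH_affine M w θ θ' σ r)
        (fun θ _ => continuous_funH M w θ) (fun θ hθ => (hs θ hθ).1) hval hmin' hθ hm hθ'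
    · exact (hval θ hθ).trans_le
        ((le_add_of_nonneg_right (by positivity)).trans (hmin' θ hθ σ hσ))
  have hset : {θ | θ ∈ designs Ω q ∧ ∀ θ' ∈ designs Ω q, energyI M w f θ' ≤ energyI M w f θ} =
      optDesigns M q w f := by
    ext θ
    constructor
    · rintro ⟨hθ, hm⟩
      exact ⟨_, hmk θ hθ hm, rfl⟩
    · rintro ⟨p, hp, rfl⟩
      exact ⟨hp.1, fun θ' hθ' => (le_add_of_nonneg_right (by positivity)).trans (hmax p hp θ' hθ')⟩
  refine ⟨?_, hset⟩
  obtain ⟨θ, hθ, hm⟩ := exists_isMax_energyI hd hΩb hM (designs_nonempty hq hqsum) hw f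
  -- For the fixed maximizer `θ`, `H(θ, p.2) ≤ H(p.1, p.2) = I(p.1) ≤ I(θ)`, so `p.2` minimizes
  -- `H(θ, ·)`.
  have huniq : ∀ p ∈ saddlePoints M q w f, p.2 = s θ := fun p hp =>
    heq θ hθ p.2 hp.2.1 <| (hp.2.2.1 θ hθ).trans <| by
      rw [hsad p hp, hval _ hp.1]
      exact hm _ hp.1
  refine ⟨s θ, (hs θ hθ).1, ⟨θ, _, hmk θ hθ hm, rfl⟩, ?_⟩
  ext ⟨θ', σ⟩
  constructor
  · intro hp
    exact ⟨⟨_, hp, rfl⟩, huniq _ hp⟩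
  · rintro ⟨⟨p, hp, hpe⟩, hσ⟩
    have h1 : p = (θ', σ) := Prod.ext hpe ((huniq p hp).trans (Set.mem_singleton_iff.1 hσ).symm)
    exact h1 ▸ hp
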